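/- **Proposition 1 (Minmax Folk Theorem).** Consider a stage game with users $i\in\mathcal N=\{1,\dots,N\}$ with action sets $A_i$, an intervention device with action set $A_0$, and bounded payoff functions $u_i:A_0\times\mathcal A\to\mathbb R$, where $\mathcal A=\prod_i A_i$; there is a null action $\underline a_0\in A_0$ with $u_i(a_0,\mathbf a)\le u_i(\underline a_0,\mathbf a)$ for all $i,a_0,\mathbf a$. In the repeated game, played in periods $t=0,1,2,\dots$ with perfect monitoring, a history $h\in\mathscr H$ is the finite (possibly empty) sequence of past action profiles, an intervention rule is a map $\sigma_0:\mathscr H\to A_0$, a strategy of user $i$ is a map $\sigma_i:\mathscr H\to A_i$, and for a discount factor $\delta\in[0,1)$ user $i$'s payoff is $U_i(\sigma_0,\sigma)=(1-\delta)\sum_{t\ge 0}\delta^t u_i(a_0^t,\mathbf a^t)$, where $(a_0^t,\mathbf a^t)$ is the profile that $(\sigma_0,\sigma)$ induces in period $t$. For a history $h$ let $\sigma_j|_h(h')=\sigma_j(hh')$. The pair $(\sigma_0,\sigma)$ is a subgame perfect equilibrium if $U_i(\sigma_0|_h,\sigma|_h)\ge U_i(\sigma_0|_h,\sigma_i'|_h,\sigma_{-i}|_h)$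 for all users $i$, all strategies $\sigma_i'$ of user $i$ and all $h\in\mathscr H$ (the device is not a strategic player). Let $$\underline v_i^w=\inf_{a_0,\mathbf a_{-i}}\ \sup_{a_i} u_i(a_0,a_i,\mathbf a_{-i})$$ be user $i$'s pure-action minmax payoff with intervention (a minimum and a maximum where these are attained), and let $$\mathscr V_w^{\dag p}=\bigl\{\mathbf v\in \mathrm{co}\{(u_1(a_0,\mathbf a),\dots,u_N(a_0,\mathbf a)):(a_0,\mathbf a)\in A_0\times\mathcal A\}\ :\ v_i>\underline v_i^w\ \ \forall i\in\mathcal N\bigr\}$$ be the set of feasible and strictly individually rational payoffs, where $\mathrm{co}$ denotes the convex hull. Suppose that there exists a mutual minmax profile, i.e. an action profile $(\hat a_0,\hat{\mathbf a})\in A_0\times\mathcal A$ with $\underline v_i^w=\sup_{a_i}u_i(\hat a_0,a_i,\hat{\mathbf a}_{-i})$ for all $i\in\mathcal N$. Then for every $\mathbf v\in\mathscr V_w^{\dag p}$ there exists $\underline\delta\in[0,1)$ such that for every $\delta\in(\underline\delta,1)$ the repeated game with discount factor $\delta$ has a subgame perfect equilibrium $(\sigma_0,\sigma)$ with $U_i(\sigma_0,\sigma)=v_i$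 for all $i\in\mathcal N$. -/

import Mathlib

/-- A stage game with `N` users (action sets `A i`) and an intervention device (action set `A₀`,
no payoff of its own). There is a null intervention action, and intervening can only decrease the
users' payoffs. -/
structure InterventionGame (N : ℕ) (A₀ : Type*) (A : Fin N → Type*) where
  payoff : Fin N → A₀ → (∀ i, A i) → ℝ
  nullAction : A₀
  payoff_le_null : ∀ (i : Fin N) (a₀ : A₀) (a : ∀ i, A i),
    payoff i a₀ a ≤ payoff i nullAction a

namespace InterventionGame

variable {N : ℕ} {A₀ : Type*} {A : Fin N → Type*}

/-- A history: the list of all action profiles played so far, oldest first. -/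
abbrev History (A₀ : Type*) (A : Fin N → Type*) := List (A₀ × (∀ i, A i))

/-- An intervention rule: an action of the device after each history. -/
abbrev Rule (A₀ : Type*) (A : Fin N → Type*) := History A₀ A → A₀

/-- A pure strategy of user `i`: an action of the user after each history. -/
abbrev Strategy (A₀ : Type*) (A : Fin N → Type*) (i : Fin N) := History A₀ A → A i

/-- The action profile prescribed at history `h`. -/
def actionAt (σ₀ : Rule A₀ A) (σ : ∀ i, Strategy A₀ A i) (h : History A₀ A) :
    A₀ × (∀ i, A i) :=
  (σ₀ h, fun i => σ i h)

/-- The history of the first `t` periods when `(σ₀, σ)` is followed from the start. -/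
def outcomeHistory (σ₀ : Rule A₀ A) (σ : ∀ i, Strategy A₀ A i) : ℕ → History A₀ A
  | 0 => []
  | t + 1 => outcomeHistory σ₀ σ t ++ [actionAt σ₀ σ (outcomeHistory σ₀ σ t)]

/-- The action profile played in period `t` when `(σ₀, σ)` is followed from the start. -/
def outcome (σ₀ : Rule A₀ A) (σ : ∀ i, Strategy A₀ A i) (t : ℕ) : A₀ × (∀ i, A i) :=
  actionAt σ₀ σ (outcomeHistory σ₀ σ t)

/-- The continuation, after history `h`, of a rule or of a strategy. -/
def continuation {X : Type*} (h : History A₀ A) (s : History A₀ A → X) : History A₀ A → X :=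
  fun h' => s (h ++ h')

/-- The normalized discounted payoff of user `i` in the repeated game. -/
noncomputable def discountedPayoff (G : InterventionGame N A₀ A) (δ : ℝ) (σ₀ : Rule A₀ A)
    (σ : ∀ i, Strategy A₀ A i) (i : Fin N) : ℝ :=
  (1 - δ) * ∑' t : ℕ, δ ^ t * G.payoff i (outcome σ₀ σ t).1 (outcome σ₀ σ t).2

/-- Subgame perfect equilibrium: after no history can a user gain by a unilateral change of
strategy. The intervention device just follows its rule. -/
def IsSubgamePerfect (G : InterventionGame N A₀ A) (δ : ℝ) (σ₀ : Rule A₀ A)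
    (σ : ∀ i, Strategy A₀ A i) : Prop :=
  ∀ (h : History A₀ A) (i : Fin N) (τ : Strategy A₀ A i),
    G.discountedPayoff δ (continuation h σ₀)
        (fun j => continuation h (Function.update σ i τ j)) i ≤
      G.discountedPayoff δ (continuation h σ₀) (fun j => continuation h (σ j)) i

/-- The best payoff of user `i` against `a₀` and the actions in `a` of the other users
(the entry `a i` plays no role). -/
noncomputable def bestPayoff (G : InterventionGame N A₀ A) (i : Fin N) (a₀ : A₀)
    (a : ∀ i, A i) : ℝ :=
  ⨆ x : A i, G.payoff i a₀ (Function.update a i x)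

/-- The pure-action minmax payoff of user `i` with intervention. -/
noncomputable def minmaxPayoff (G : InterventionGame N A₀ A) (i : Fin N) : ℝ :=
  ⨅ p : A₀ × (∀ i, A i), G.bestPayoff i p.1 p.2

/-- A pure action profile that minmaxes all users simultaneously. -/
def IsMutualMinmax (G : InterventionGame N A₀ A) (a₀ : A₀) (a : ∀ i, A i) : Prop :=
  ∀ i, G.minmaxPayoff i = G.bestPayoff i a₀ a

/-- The feasible payoffs: the convex hull of the payoff vectors of pure action profiles. -/
def feasible (G : InterventionGame N A₀ A) : Set (Fin N → ℝ) :=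
  convexHull ℝ {v | ∃ (a₀ : A₀) (a : ∀ i, A i), v = fun i => G.payoff i a₀ a}

/-- The feasible and strictly individually rational payoffs. -/
def feasibleStrictlyIR (G : InterventionGame N A₀ A) : Set (Fin N → ℝ) :=
  {v | v ∈ G.feasible ∧ ∀ i, G.minmaxPayoff i < v i}

end InterventionGame

/-! Play a path worth exactly `v`; after any deviation play the mutual minmax profile for `L`
periods, then start the path anew. A deviation during the punishment restarts it.

Values: the path exists because a point of a convex hull is an exact discounted average of pure
payoffs, chosen greedily so that every continuation value stays within `ε` of `v`
(`exists_discounted_path`). No public randomization is needed.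

Incentives: let `P` be the value at the start of the punishment. A deviator there gets at most the
minmax payoff, hence at most `P`, now and `P` afterwards; values only rise as the punishment runs
off. On the path, a deviation gains at most order `1 - δ` now, while `P` is at least `2 * ε` below
`v`. Both need `δ ^ L` in a fixed interval `[q, q']` below one, which powers of `δ` near one must
hit (`exists_pow_mem_Icc`). One-shot deviations suffice by `isSubgamePerfect_path`. -/

open Filter Topology

namespace InterventionGame

/-! ### Discounted sums and exact discounted averages -/

section DiscountedSums

/-- A bounded value process that dominates its one-step discounted update dominates the
normalized discounted sum of the flow payoffs. -/
theorem discounted_sum_le {δ : ℝ} (hδ0 : 0 ≤ δ) (hδ1 : δ < 1) {c V : ℕ → ℝ} {C B : ℝ}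
    (hc : ∀ t, |c t| ≤ C) (hV : ∀ t, |V t| ≤ B)
    (hstep : ∀ t, (1 - δ) * c t + δ * V (t + 1) ≤ V t) :
    (1 - δ) * ∑' t, δ ^ t * c t ≤ V 0 := by
  have hsum : Summable fun t => δ ^ t * c t := by
    refine Summable.of_norm_bounded
      ((summable_geometric_of_lt_one hδ0 hδ1).mul_right C) fun t => ?_
    rw [Real.norm_eq_abs, abs_mul, abs_of_nonneg (pow_nonneg hδ0 t)]
    exact mul_le_mul_of_nonneg_left (hc t) (pow_nonneg hδ0 t)
  -- Iterate the one-step inequality; the remainder `δ ^ T * V T` vanishes because `V` is bounded.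
  have hpartial : ∀ T, (1 - δ) * ∑ t ∈ Finset.range T, δ ^ t * c t + δ ^ T * V T ≤ V 0 := by
    intro T
    induction T with
    | zero => simp
    | succ T ih =>
      have h := mul_le_mul_of_nonneg_left (hstep T) (pow_nonneg hδ0 T)
      rw [Finset.sum_range_succ, pow_succ]
      linarith
  have hzero : Tendsto (fun T => δ ^ T * V T) atTop (𝓝 0) := by
    refine squeeze_zero_norm (a := fun T => δ ^ T * B) (fun T => ?_) ?_
    · rw [Real.norm_eq_abs, abs_mul, abs_of_nonneg (pow_nonneg hδ0 T)]
      exact mul_le_mul_of_nonneg_left (hV T) (pow_nonneg hδ0 T)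
    · simpa using (tendsto_pow_atTop_nhds_zero_of_lt_one hδ0 hδ1).mul_const B
  have hlim := (hsum.hasSum.tendsto_sum_nat.const_mul (1 - δ)).add hzero
  rw [add_zero] at hlim
  exact le_of_tendsto' hlim hpartial

/-- A bounded value process that equals its one-step discounted update is the normalized
discounted sum of the flow payoffs. -/
theorem discounted_sum_eq {δ : ℝ} (hδ0 : 0 ≤ δ) (hδ1 : δ < 1) {c V : ℕ → ℝ} {C B : ℝ}
    (hc : ∀ t, |c t| ≤ C) (hV : ∀ t, |V t| ≤ B)
    (hstep : ∀ t, (1 - δ) * c t + δ * V (t + 1) = V t) :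
    (1 - δ) * ∑' t, δ ^ t * c t = V 0 := by
  refine le_antisymm (discounted_sum_le hδ0 hδ1 hc hV fun t => (hstep t).le) ?_
  have h := discounted_sum_le (c := fun t => -c t) (V := fun t => -V t) (C := C) (B := B)
    hδ0 hδ1 (fun t => by simpa using hc t) (fun t => by simpa using hV t)
    (fun t => by linarith [hstep t])
  simp only [mul_neg, tsum_neg] at h
  linarith

/-- Greedy choice of a sequence of indices whose discounted frequencies are exactly `l`.
The discounted frequencies of its continuations are `l + y t`. -/
theorem exists_discounted_frequencies {ι : Type*} [Fintype ι] [DecidableEq ι] {l : ι → ℝ}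
    (hl : ∑ k, l k = 1) {r δ : ℝ} (hr : 0 ≤ r) (hrl : ∀ k, r ≤ l k) (hδ0 : 0 < δ)
    (hδ1 : δ ≤ 1) (hδr : 1 - δ ≤ δ * r) :
    ∃ (k : ℕ → ι) (y : ℕ → ι → ℝ), y 0 = 0 ∧ (∀ t j, -r ≤ y t j) ∧ (∀ t, ∑ j, y t j = 0) ∧
      ∀ t j, δ * y (t + 1) j = y t j + (1 - δ) * (l j - if j = k t then 1 else 0) := by
  have hne : (Finset.univ : Finset ι).Nonempty := by
    rw [Finset.nonempty_iff_ne_empty]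
    intro h
    simp [h] at hl
  have hpos : ∀ z : ι → ℝ, ∑ j, z j = 0 → ∃ k, 0 ≤ z k := by
    intro z hz
    by_contra! h
    exact absurd hz (Finset.sum_neg (fun j _ => h j) hne).ne
  let S := {z : ι → ℝ // (∀ j, -r ≤ z j) ∧ ∑ j, z j = 0}
  -- Only the chosen coordinate can lose mass. It starts at `0` or above and loses at most `1 - δ ≤
  -- δ * r`; the others keep the bound because `l j ≥ r` offsets the division by `δ`.
  let pick : S → ι := fun z => (hpos z.1 z.2.2).choose
  have hpick : ∀ z : S, 0 ≤ z.1 (pick z) := fun z => (hpos z.1 z.2.2).choose_spec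
  let next : S → S := fun z =>
    ⟨fun j => (z.1 j + (1 - δ) * (l j - if j = pick z then 1 else 0)) / δ, by
      constructor
      · intro j
        rw [le_div_iff₀ hδ0]
        have h1 := z.2.1 j
        have h2 : (1 - δ) * r ≤ (1 - δ) * l j :=
          mul_le_mul_of_nonneg_left (hrl j) (by linarith)
        have h3 : 0 ≤ (1 - δ) * r := mul_nonneg (by linarith) hr
        split_ifs with hj
        · have h4 := hpick z
          rw [← hj] at h4
          linarith
        · linarith
      · rw [← Finset.sum_div, Finset.sum_add_distrib, ← Finset.mul_sum,
          Finset.sum_sub_distrib, z.2.2, hl]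
        simp⟩
  let s : ℕ → S := fun t => next^[t] ⟨0, fun _ => by simpa using hr, by simp⟩
  refine ⟨fun t => pick (s t), fun t => (s t).1, rfl, fun t => (s t).2.1,
    fun t => (s t).2.2, fun t j => ?_⟩
  have hs : s (t + 1) = next (s t) := Function.iterate_succ_apply' _ _ _
  simp only [hs, next]
  field_simp

/-- A point of a convex hull is exactly the discounted average of a sequence of points of the
set, with all continuation values close to it, once the discount factor is large. -/
theorem exists_discounted_path {N : ℕ} {X : Set (Fin N → ℝ)} {v : Fin N → ℝ}
    (hv : v ∈ convexHull ℝ X) {M ε : Fin N → ℝ} (hX : ∀ x ∈ X, ∀ i, |x i| ≤ M i)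
    (hε : ∀ i, 0 < ε i) :
    ∀ᶠ δ in 𝓝[<] (1 : ℝ), ∃ (x : ℕ → Fin N → ℝ) (W : ℕ → Fin N → ℝ), (∀ t, x t ∈ X) ∧
      W 0 = v ∧ (∀ t i, |W t i - v i| ≤ ε i) ∧
      ∀ t i, (1 - δ) * x t i + δ * W (t + 1) i = W t i := by
  classical
  obtain ⟨ι, _, z, l, hz, -, hl0, hl1, hlv⟩ := eq_pos_convex_span_of_mem_convexHull hv
  have hr : ∃ r : ℝ, 0 < r ∧ (∀ k, r ≤ l k) ∧ ∀ i, 2 * r * Fintype.card ι * M i ≤ ε i := by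
    have h1 : ∀ᶠ r in 𝓝[>] (0 : ℝ), ∀ k, r ≤ l k := eventually_all.2 fun k =>
      nhdsWithin_le_nhds ((eventually_lt_nhds (hl0 k)).mono fun _ h => h.le)
    have h2 : ∀ᶠ r in 𝓝[>] (0 : ℝ), ∀ i, 2 * r * Fintype.card ι * M i ≤ ε i := by
      refine eventually_all.2 fun i => nhdsWithin_le_nhds ?_
      have : Tendsto (fun r : ℝ => 2 * r * Fintype.card ι * M i) (𝓝 0) (𝓝 0) := by
        have hcont : Continuous fun r : ℝ => 2 * r * Fintype.card ι * M i := by fun_prop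
        simpa using hcont.tendsto 0
      exact (this.eventually_lt_const (hε i)).mono fun _ h => h.le
    obtain ⟨r, h0, h1, h2⟩ := (eventually_mem_nhdsWithin.and (h1.and h2)).exists
    exact ⟨r, h0, h1, h2⟩
  obtain ⟨r, hr0, hrl, hrε⟩ := hr
  have hδr : ∀ᶠ δ in 𝓝[<] (1 : ℝ), 1 - δ ≤ δ * r := by
    refine nhdsWithin_le_nhds ?_
    have : Tendsto (fun δ : ℝ => δ * r - (1 - δ)) (𝓝 1) (𝓝 r) := by
      have hcont : Continuous fun δ : ℝ => δ * r - (1 - δ) := by fun_prop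
      simpa using hcont.tendsto 1
    exact (this.eventually_const_lt hr0).mono fun _ h => by linarith
  filter_upwards [hδr, self_mem_nhdsWithin,
    nhdsWithin_le_nhds (eventually_gt_nhds (zero_lt_one (α := ℝ)))] with δ hδr hδ1 hδ0
  obtain ⟨k, y, hy0, hyr, hysum, hystep⟩ :=
    exists_discounted_frequencies hl1 hr0.le hrl hδ0 (le_of_lt hδ1) hδr
  have hzM : ∀ j i, |z j i| ≤ M i := fun j i => hX _ (hz ⟨j, rfl⟩) i
  have hlv' : ∀ i, ∑ j, l j * z j i = v i := fun i => by
    rw [← hlv]; simp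
  refine ⟨fun t => z (k t), fun t i => v i + ∑ j, y t j * z j i,
    fun t => hz ⟨_, rfl⟩, by simp [hy0], fun t i => ?_, fun t i => ?_⟩
  · have h1 : ∑ j, y t j * z j i = ∑ j, (y t j + r) * z j i - ∑ j, r * z j i := by
      rw [← Finset.sum_sub_distrib]
      exact Finset.sum_congr rfl fun j _ => by ring
    have h2 : |∑ j, (y t j + r) * z j i| ≤ ∑ j, (y t j + r) * M i :=
      (Finset.abs_sum_le_sum_abs _ _).trans <| Finset.sum_le_sum fun j _ => by
        rw [abs_mul, abs_of_nonneg (by linarith [hyr t j])]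
        exact mul_le_mul_of_nonneg_left (hzM j i) (by linarith [hyr t j])
    have h3 : |∑ j, r * z j i| ≤ ∑ _j : ι, r * M i :=
      (Finset.abs_sum_le_sum_abs _ _).trans <| Finset.sum_le_sum fun j _ => by
        rw [abs_mul, abs_of_pos hr0]
        exact mul_le_mul_of_nonneg_left (hzM j i) hr0.le
    have h4 : ∑ j, (y t j + r) * M i = Fintype.card ι * (r * M i) := by
      rw [← Finset.sum_mul, Finset.sum_add_distrib, hysum]
      simp [mul_assoc]
    have h5 : ∑ _j : ι, r * M i = Fintype.card ι * (r * M i) := by simp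
    have h6 := abs_sub (∑ j, (y t j + r) * z j i) (∑ j, r * z j i)
    rw [add_sub_cancel_left, h1]
    linarith [hrε i]
  · have h1 : δ * ∑ j, y (t + 1) j * z j i
        = ∑ j, y t j * z j i + (1 - δ) * (v i - z (k t) i) := by
      rw [← hlv' i, Finset.mul_sum]
      have h2 : z (k t) i = ∑ j, (if j = k t then 1 else 0) * z j i := by simp
      rw [h2, ← Finset.sum_sub_distrib, Finset.mul_sum, ← Finset.sum_add_distrib]
      refine Finset.sum_congr rfl fun j _ => ?_
      rw [← mul_assoc, hystep]
      ring
    rw [mul_add, h1]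
    ring

/-- Powers of a discount factor close to one do not skip an interval below one. -/
theorem exists_pow_mem_Icc {q q' δ : ℝ} (hq' : q' < 1) (hδ0 : 0 ≤ δ) (hδ1 : δ < 1)
    (hq0 : 0 < q') (h : q ≤ δ * q') : ∃ L : ℕ, q ≤ δ ^ L ∧ δ ^ L ≤ q' := by
  classical
  -- The least such exponent works: it is positive as `q' < 1`, and the power before it exceeds
  -- `q'`.
  have hex : ∃ n : ℕ, δ ^ n ≤ q' := (exists_pow_lt_of_lt_one hq0 hδ1).imp fun _ h => h.le
  refine ⟨Nat.find hex, ?_, Nat.find_spec hex⟩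
  obtain ⟨n, hn⟩ : ∃ n, Nat.find hex = n + 1 := by
    refine Nat.exists_eq_succ_of_ne_zero fun h0 => ?_
    have := Nat.find_spec hex
    rw [h0, pow_zero] at this
    linarith
  have hlt : q' < δ ^ n := not_le.1 (Nat.find_min hex (by omega))
  rw [hn, pow_succ']
  exact h.trans (mul_le_mul_of_nonneg_left hlt.le hδ0)

end DiscountedSums

/-! ### Restarting path strategies and one-shot deviations -/

section PathStrategies

variable {N : ℕ} {A₀ : Type*} {A : Fin N → Type*}

open Classical in
/-- The position on the path `b` after a history: it moves up by one when the path was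
followed and returns to `0` otherwise. -/
noncomputable def pathState (b : ℕ → A₀ × (∀ i, A i)) (n : ℕ) (h : History A₀ A) : ℕ :=
  h.foldl (fun m p => if p = b m then m + 1 else 0) n

/-- The intervention rule that follows the path `b` from position `n` and restarts `b` after
every deviation. -/
noncomputable def pathRule (b : ℕ → A₀ × (∀ i, A i)) (n : ℕ) : Rule A₀ A :=
  fun h => (b (pathState b n h)).1

/-- The strategies that follow the path `b` from position `n` and restart `b` after every
deviation. -/
noncomputable def pathStrategy (b : ℕ → A₀ × (∀ i, A i)) (n : ℕ) (i : Fin N) :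
    Strategy A₀ A i :=
  fun h => (b (pathState b n h)).2 i

open Classical in
theorem pathState_concat (b : ℕ → A₀ × (∀ i, A i)) (n : ℕ) (h : History A₀ A)
    (p : A₀ × (∀ i, A i)) :
    pathState b n (h ++ [p]) = if p = b (pathState b n h) then pathState b n h + 1 else 0 := by
  simp only [pathState, List.foldl_append, List.foldl_cons, List.foldl_nil]
  congr

theorem pathState_outcomeHistory (b : ℕ → A₀ × (∀ i, A i)) (n : ℕ) (h : History A₀ A) (t : ℕ) :
    pathState b n (h ++ outcomeHistory (continuation h (pathRule b n))
      (fun j => continuation h (pathStrategy b n j)) t) = pathState b n h + t := by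
  induction t with
  | zero => simp [outcomeHistory]
  | succ t ih =>
    rw [outcomeHistory, ← List.append_assoc, pathState_concat, ih, if_pos, add_assoc]
    simp only [actionAt, continuation, pathRule, pathStrategy, ih]

theorem outcome_path (b : ℕ → A₀ × (∀ i, A i)) (n : ℕ) (h : History A₀ A) (t : ℕ) :
    outcome (continuation h (pathRule b n)) (fun j => continuation h (pathStrategy b n j)) t
      = b (pathState b n h + t) := by
  rw [← pathState_outcomeHistory, outcome]
  rfl

variable (G : InterventionGame N A₀ A) {δ : ℝ} {b : ℕ → A₀ × (∀ i, A i)}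
  {V : Fin N → ℕ → ℝ}

theorem discountedPayoff_path (hδ0 : 0 ≤ δ) (hδ1 : δ < 1)
    (hbdd : ∀ i, ∃ M : ℝ, ∀ (a₀ : A₀) (a : ∀ i, A i), |G.payoff i a₀ a| ≤ M)
    (hVb : ∀ i, ∃ B : ℝ, ∀ m, |V i m| ≤ B)
    (hV : ∀ i m, (1 - δ) * G.payoff i (b m).1 (b m).2 + δ * V i (m + 1) = V i m)
    (n : ℕ) (h : History A₀ A) (i : Fin N) :
    G.discountedPayoff δ (continuation h (pathRule b n))
      (fun j => continuation h (pathStrategy b n j)) i = V i (pathState b n h) := by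
  obtain ⟨M, hM⟩ := hbdd i
  obtain ⟨B, hB⟩ := hVb i
  simp only [discountedPayoff, outcome_path]
  exact discounted_sum_eq (V := fun t => V i (pathState b n h + t)) hδ0 hδ1
    (fun t => hM _ _) (fun t => hB _) (fun t => hV i _)

/-- One-shot deviation principle for the strategies that follow a path and restart it after
every deviation. -/
theorem isSubgamePerfect_path (hδ0 : 0 ≤ δ) (hδ1 : δ < 1)
    (hbdd : ∀ i, ∃ M : ℝ, ∀ (a₀ : A₀) (a : ∀ i, A i), |G.payoff i a₀ a| ≤ M)
    (hVb : ∀ i, ∃ B : ℝ, ∀ m, |V i m| ≤ B)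
    (hV : ∀ i m, (1 - δ) * G.payoff i (b m).1 (b m).2 + δ * V i (m + 1) = V i m)
    (hdev : ∀ i m (x : A i),
      (1 - δ) * G.payoff i (b m).1 (Function.update (b m).2 i x) + δ * V i 0 ≤ V i m)
    (n : ℕ) : G.IsSubgamePerfect δ (pathRule b n) (pathStrategy b n) := by
  intro h i τ
  rw [discountedPayoff_path G hδ0 hδ1 hbdd hVb hV]
  obtain ⟨M, hM⟩ := hbdd i
  obtain ⟨B, hB⟩ := hVb i
  set σ₀ := continuation h (pathRule b n)
  set σ : ∀ j, Strategy A₀ A j :=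
    fun j => continuation h (Function.update (pathStrategy b n) i τ j)
  -- The position summarizes the whole history, so `V i (s t)` serves as the dominating value
  -- process for an arbitrary `τ`.
  let s : ℕ → ℕ := fun t => pathState b n (h ++ outcomeHistory σ₀ σ t)
  have hout : ∀ t, outcome σ₀ σ t = ((b (s t)).1,
      Function.update (b (s t)).2 i (τ (h ++ outcomeHistory σ₀ σ t))) := by
    intro t
    refine Prod.ext rfl (funext fun j => ?_)
    rcases eq_or_ne j i with rfl | hj
    · simp [outcome, actionAt, σ, continuation]
    · simp [outcome, actionAt, σ, continuation, hj, pathStrategy, s]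
  have key := discounted_sum_le (c := fun t => G.payoff i (outcome σ₀ σ t).1 (outcome σ₀ σ t).2)
    (V := fun t => V i (s t)) hδ0 hδ1 (fun t => hM _ _) (fun t => hB _) (fun t => by
      classical
      have hs : s (t + 1) = if outcome σ₀ σ t = b (s t) then s t + 1 else 0 := by
        simp only [s, outcomeHistory, ← List.append_assoc]
        rw [pathState_concat]
        rfl
      by_cases hc : outcome σ₀ σ t = b (s t)
      · rw [hs, if_pos hc, hc]
        exact (hV i (s t)).le
      · rw [hs, if_neg hc, hout t]
        exact hdev i (s t) _)
  simpa [s, outcomeHistory, discountedPayoff] using key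

end PathStrategies

/-! ### Punishment by the mutual minmax profile -/

section FolkTheorem

variable {N : ℕ} {A₀ : Type*} {A : Fin N → Type*}

/-- Boundedness matters: a real supremum of an unbounded set defaults to `0`. -/
theorem payoff_update_le_bestPayoff (G : InterventionGame N A₀ A) {i : Fin N} {M : ℝ}
    (hM : ∀ (a₀ : A₀) (a : ∀ i, A i), |G.payoff i a₀ a| ≤ M) (a₀ : A₀) (a : ∀ i, A i)
    (x : A i) : G.payoff i a₀ (Function.update a i x) ≤ G.bestPayoff i a₀ a :=
  le_ciSup (f := fun x => G.payoff i a₀ (Function.update a i x))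
    ⟨M, by rintro _ ⟨y, rfl⟩; exact (abs_le.1 (hM _ _)).2⟩ x

/-- A path whose continuation values stay close to `v` is sustained by the threat of playing
a mutual minmax profile for `L` periods before the path starts anew. -/
theorem exists_isSubgamePerfect_of_path (G : InterventionGame N A₀ A) {δ : ℝ} (hδ0 : 0 ≤ δ)
    (hδ1 : δ < 1) {M : Fin N → ℝ}
    (hM : ∀ i (a₀ : A₀) (a : ∀ i, A i), |G.payoff i a₀ a| ≤ M i)
    {p : A₀ × (∀ i, A i)} (hp : G.IsMutualMinmax p.1 p.2) {v ε : Fin N → ℝ}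
    {a : ℕ → A₀ × (∀ i, A i)} {W : ℕ → Fin N → ℝ} (hW0 : W 0 = v)
    (hWε : ∀ t i, |W t i - v i| ≤ ε i)
    (hW : ∀ t i, (1 - δ) * G.payoff i (a t).1 (a t).2 + δ * W (t + 1) i = W t i)
    (L : ℕ) {P : Fin N → ℝ}
    (hP : ∀ i, P i = (1 - δ ^ L) * G.payoff i p.1 p.2 + δ ^ L * v i)
    (hpv : ∀ i, G.payoff i p.1 p.2 ≤ v i)
    (hPm : ∀ i, G.minmaxPayoff i ≤ P i)
    (hPv : ∀ i, (1 - δ) * M i + δ * P i ≤ v i - ε i) :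
    ∃ (σ₀ : Rule A₀ A) (σ : ∀ i, Strategy A₀ A i),
      G.IsSubgamePerfect δ σ₀ σ ∧ ∀ i, G.discountedPayoff δ σ₀ σ i = v i := by
  let b : ℕ → A₀ × (∀ i, A i) := fun n => if n < L then p else a (n - L)
  let V : Fin N → ℕ → ℝ := fun i n =>
    if n < L then (1 - δ ^ (L - n)) * G.payoff i p.1 p.2 + δ ^ (L - n) * v i
    else W (n - L) i
  have hVlow : ∀ i n, n < L →
      V i n = (1 - δ ^ (L - n)) * G.payoff i p.1 p.2 + δ ^ (L - n) * v i :=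
    fun i n h => if_pos h
  have hVhigh : ∀ i n, ¬ n < L → V i n = W (n - L) i := fun i n h => if_neg h
  -- The two formulas for `V` agree at the seam `n = L` because `W 0 = v`.
  have hVle : ∀ i n, n ≤ L →
      V i n = (1 - δ ^ (L - n)) * G.payoff i p.1 p.2 + δ ^ (L - n) * v i := by
    intro i n hn
    rcases hn.lt_or_eq with h | rfl
    · exact hVlow i n h
    · rw [hVhigh i n (lt_irrefl n)]
      simp [hW0]
  have hV0 : ∀ i, V i 0 = P i := fun i => by rw [hVle i 0 (Nat.zero_le _), hP, Nat.sub_zero]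
  have hVL : ∀ i, V i L = v i := fun i => by simp [hVle i L le_rfl]
  have hVb : ∀ i, ∃ B : ℝ, ∀ m, |V i m| ≤ B := by
    intro i
    refine ⟨max (M i + |v i|) (|v i| + ε i), fun n => ?_⟩
    by_cases hn : n < L
    · refine le_max_of_le_left ?_
      rw [hVlow i n hn]
      have h0 : 0 ≤ δ ^ (L - n) := pow_nonneg hδ0 _
      have h1 : δ ^ (L - n) ≤ 1 := pow_le_one₀ hδ0 hδ1.le
      refine (abs_add_le _ _).trans (add_le_add ?_ ?_)
      · rw [abs_mul, abs_of_nonneg (by linarith)]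
        exact (mul_le_of_le_one_left (abs_nonneg _) (by linarith)).trans (hM i _ _)
      · rw [abs_mul, abs_of_nonneg h0]
        exact mul_le_of_le_one_left (abs_nonneg _) h1
    · refine le_max_of_le_right ?_
      rw [hVhigh i n hn]
      linarith [hWε (n - L) i, abs_sub_abs_le_abs_sub (W (n - L) i) (v i)]
  have hV : ∀ i m, (1 - δ) * G.payoff i (b m).1 (b m).2 + δ * V i (m + 1) = V i m := by
    intro i m
    by_cases hm : m < L
    · have hL : L - m = (L - (m + 1)) + 1 := by omega
      rw [hVle i m hm.le, hVle i (m + 1) hm, hL, pow_succ]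
      simp only [b, if_pos hm]
      ring
    · rw [hVhigh i m hm, hVhigh i (m + 1) (by omega), show m + 1 - L = m - L + 1 by omega]
      simp only [b, if_neg hm]
      exact hW _ i
  have hdev : ∀ i m (x : A i),
      (1 - δ) * G.payoff i (b m).1 (Function.update (b m).2 i x) + δ * V i 0 ≤ V i m := by
    intro i m x
    rw [hV0]
    by_cases hm : m < L
    · have hbest := payoff_update_le_bestPayoff G (hM i) p.1 p.2 x
      rw [← hp i] at hbest
      simp only [b, if_pos hm]
      have h1 := mul_le_mul_of_nonneg_left (hbest.trans (hPm i)) (sub_nonneg.2 hδ1.le)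
      have h2 : P i ≤ V i m := by
        rw [hP, hVlow i m hm]
        have h3 : δ ^ L ≤ δ ^ (L - m) := pow_le_pow_of_le_one hδ0 hδ1.le (Nat.sub_le _ _)
        have h4 := mul_le_mul_of_nonneg_right h3 (sub_nonneg.2 (hpv i))
        linarith
      linarith
    · rw [hVhigh i m hm]
      have h1 := mul_le_mul_of_nonneg_left
        (abs_le.1 (hM i (b m).1 (Function.update (b m).2 i x))).2 (sub_nonneg.2 hδ1.le)
      linarith [hPv i, (abs_le.1 (hWε (m - L) i)).1]
  have hbdd : ∀ i, ∃ M : ℝ, ∀ (a₀ : A₀) (a : ∀ i, A i), |G.payoff i a₀ a| ≤ M :=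
    fun i => ⟨M i, hM i⟩
  refine ⟨pathRule b L, pathStrategy b L,
    isSubgamePerfect_path G hδ0 hδ1 hbdd hVb hV hdev L, fun i => ?_⟩
  rw [← hVL i]
  exact discountedPayoff_path G hδ0 hδ1 hbdd hVb hV L [] i

end FolkTheorem

end InterventionGame

theorem proposition1 {N : ℕ} {A₀ : Type*} {A : Fin N → Type*} (G : InterventionGame N A₀ A)
    (hbdd : ∀ i, ∃ M : ℝ, ∀ (a₀ : A₀) (a : ∀ i, A i), |G.payoff i a₀ a| ≤ M)
    (hminmax : ∃ (a₀ : A₀) (a : ∀ i, A i), G.IsMutualMinmax a₀ a)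
    (v : Fin N → ℝ) (hv : v ∈ G.feasibleStrictlyIR) :
    ∃ δ₀ : ℝ, 0 ≤ δ₀ ∧ δ₀ < 1 ∧ ∀ δ : ℝ, δ₀ < δ → δ < 1 →
      ∃ (σ₀ : InterventionGame.Rule A₀ A) (σ : ∀ i, InterventionGame.Strategy A₀ A i),
        G.IsSubgamePerfect δ σ₀ σ ∧ ∀ i, G.discountedPayoff δ σ₀ σ i = v i := by
  obtain ⟨p₀, p, hp⟩ := hminmax
  obtain ⟨hfeas, hIR⟩ := hv
  choose M hM using hbdd
  have hpm : ∀ i, G.payoff i p₀ p ≤ G.minmaxPayoff i := fun i => by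
    have h := G.payoff_update_le_bestPayoff (hM i) p₀ p (p i)
    rwa [Function.update_eq_self, ← hp i] at h
  have hpv : ∀ i, G.payoff i p₀ p < v i := fun i => (hpm i).trans_lt (hIR i)
  -- Weight `q` on `v` keeps the punishment value at or above minmax; `q' > q` below keeps it away
  -- from `v`.
  obtain ⟨q, hq0, hq1, hqm⟩ : ∃ q : ℝ, 0 < q ∧ q < 1 ∧
      ∀ i, G.minmaxPayoff i ≤ (1 - q) * G.payoff i p₀ p + q * v i := by
    have h : ∀ᶠ q in 𝓝[<] (1 : ℝ), ∀ i,
        G.minmaxPayoff i ≤ (1 - q) * G.payoff i p₀ p + q * v i := by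
      refine eventually_all.2 fun i => nhdsWithin_le_nhds ?_
      have hcont : Continuous fun q : ℝ => (1 - q) * G.payoff i p₀ p + q * v i := by fun_prop
      have hlim := hcont.tendsto 1
      simp only [sub_self, zero_mul, one_mul, zero_add] at hlim
      exact (hlim.eventually_const_lt (hIR i)).mono fun _ h => h.le
    obtain ⟨q, h1, h2, h3⟩ := (eventually_mem_nhdsWithin.and
      (h.and (nhdsWithin_le_nhds (eventually_gt_nhds (zero_lt_one (α := ℝ)))))).exists
    exact ⟨q, h3, h1, h2⟩
  obtain ⟨q', hqq', hq'1⟩ := exists_between hq1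
  have hq'0 : 0 < q' := hq0.trans hqq'
  -- Half the least loss from punishment: one half covers the deviation gain, the other the drift of
  -- the path values.
  let ε : Fin N → ℝ := fun i => (1 - q') * (v i - G.payoff i p₀ p) / 2
  have hε : ∀ i, 0 < ε i := fun i =>
    half_pos (mul_pos (sub_pos.2 hq'1) (sub_pos.2 (hpv i)))
  have hpath := InterventionGame.exists_discounted_path hfeas (M := M) (ε := ε)
    (by rintro _ ⟨a₀, a, rfl⟩ i; exact hM i a₀ a) hε
  have hgain : ∀ᶠ δ in 𝓝[<] (1 : ℝ), ∀ i, (1 - δ) * (M i - G.minmaxPayoff i) ≤ ε i := by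
    refine eventually_all.2 fun i => nhdsWithin_le_nhds ?_
    have hcont : Continuous fun δ : ℝ => (1 - δ) * (M i - G.minmaxPayoff i) := by fun_prop
    have hlim := hcont.tendsto 1
    simp only [sub_self, zero_mul] at hlim
    exact (hlim.eventually_lt_const (hε i)).mono fun _ h => h.le
  have hpow : ∀ᶠ δ in 𝓝[<] (1 : ℝ), q ≤ δ * q' := by
    refine nhdsWithin_le_nhds ?_
    have hcont : Continuous fun δ : ℝ => δ * q' := by fun_prop
    have hlim := hcont.tendsto 1
    simp only [one_mul] at hlim
    exact (hlim.eventually_const_lt hqq').mono fun _ h => h.le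
  obtain ⟨δ₁, hδ₁, hsub⟩ := mem_nhdsLT_iff_exists_Ioo_subset.1 (hpath.and (hgain.and hpow))
  refine ⟨max δ₁ 0, le_max_right _ _, max_lt hδ₁ one_pos, fun δ hδ hδ1 => ?_⟩
  have hδ0 : 0 ≤ δ := ((le_max_right _ _).trans_lt hδ).le
  obtain ⟨⟨x, W, hx, hW0, hWε, hW⟩, hgainδ, hpowδ⟩ :=
    hsub ⟨(le_max_left _ _).trans_lt hδ, hδ1⟩
  choose a₀ a ha using hx
  obtain ⟨L, hqL, hLq'⟩ := InterventionGame.exists_pow_mem_Icc hq'1 hδ0 hδ1 hq'0 hpowδ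
  have hPm : ∀ i, G.minmaxPayoff i ≤ (1 - δ ^ L) * G.payoff i p₀ p + δ ^ L * v i := fun i => by
    have h := mul_le_mul_of_nonneg_right hqL (sub_nonneg.2 (hpv i).le)
    linarith [hqm i]
  refine G.exists_isSubgamePerfect_of_path hδ0 hδ1 hM (p := (p₀, p)) hp (ε := ε)
    (a := fun t => (a₀ t, a t)) hW0 hWε (fun t i => ?_) L (fun i => rfl)
    (fun i => (hpv i).le) hPm (fun i => ?_)
  · rw [← hW t i, ha t]
  · have h1 := mul_le_mul_of_nonneg_right hLq' (sub_nonneg.2 (hpv i).le)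
    have h2 := mul_le_mul_of_nonneg_left (hPm i) (sub_nonneg.2 hδ1.le)
    have h3 : 2 * ε i = (1 - q') * (v i - G.payoff i p₀ p) := by simp only [ε]; ring
    linarith [hgainδ i]
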